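/- Let $1<p<\infty$ and let $\omega=(\omega_n)_{n\ge 0}$ be a sequence of positive numbers with $\lim_{n\to\infty}\omega_n/\omega_{n+1}=1$. Let $H(\mathbb D)$ be the space of holomorphic functions on the unit disc, and for $f\in H(\mathbb D)$ let $\hat f(n)$ be its Taylor coefficients at $0$. Let $\ell^p_A(\omega)$ be the space of all $f\in H(\mathbb D)$ with $$\|f\|:=\Big(\sum_{n=0}^\infty|\hat f(n)|^p\,\omega_n\Big)^{1/p}<\infty .$$ For $g,f\in H(\mathbb D)$ put $T_g f(z)=\int_0^z f(t)g'(t)\,dt$. Let $\mathrm{Mult}(\ell^p_A(\omega))$ be the set of all $g\in H(\mathbb D)$ such that $gf\in\ell^p_A(\omega)$ for every $f\in\ell^p_A(\omega)$, and let $T(\ell^p_A(\omega))$ be the space of all $g\in H(\mathbb D)$ such that $T_g$ maps $\ell^p_A(\omega)$ boundedly into itself, equipped with the seminorm $g\mapsto\|T_g\|$ (the operator norm of $T_g$ on $\ell^p_A(\omega)$). Then $$\mathrm{Mult}(\ell^p_A(\omega))\subseteq T(\ell^p_A(\omega)).$$ Furthermore, if $g\in T(\ell^p_A(\omega))$ lies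 in the closure of $\mathrm{Mult}(\ell^p_A(\omega))$ in $T(\ell^p_A(\omega))$ with respect to this seminorm, then $T_g$ is quasi-nilpotent on $\ell^p_A(\omega)$, i.e. $\sigma(T_g\,|\,\ell^p_A(\omega))=\{0\}$. -/

import Mathlib

open Filter Topology
open scoped Complex.UnitDisc

noncomputable section

namespace VolterraLp

/-- A function on the unit disc, extended by `0` to the complex plane. -/
def ext (f : 𝔻 → ℂ) (z : ℂ) : ℂ :=
  if h : ‖z‖ < 1 then f (Complex.UnitDisc.mk z h) else 0

theorem ext_of_lt (f : 𝔻 → ℂ) {z : ℂ} (h : ‖z‖ < 1) :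
    ext f z = f (Complex.UnitDisc.mk z h) := dif_pos h

theorem ext_coe (f : 𝔻 → ℂ) (z : 𝔻) : ext f (z : ℂ) = f z := by
  rw [ext_of_lt f z.norm_lt_one, Complex.UnitDisc.mk_coe]

/-- The algebra of holomorphic functions `𝔻 → ℂ` on the unit disc. -/
def holSubalgebra : Subalgebra ℂ (𝔻 → ℂ) where
  carrier := {f | DifferentiableOn ℂ (ext f) (Metric.ball 0 1)}
  mul_mem' := by
    intro f g hf hg
    refine (DifferentiableOn.mul hf hg).congr fun z hz => ?_
    rw [mem_ball_zero_iff] at hz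
    simp [ext_of_lt _ hz]
  add_mem' := by
    intro f g hf hg
    refine (DifferentiableOn.add hf hg).congr fun z hz => ?_
    rw [mem_ball_zero_iff] at hz
    simp [ext_of_lt _ hz]
  algebraMap_mem' := by
    intro c
    refine (differentiableOn_const c).congr fun z hz => ?_
    rw [mem_ball_zero_iff] at hz
    simp [ext_of_lt _ hz]

/-- `H(𝔻)`, the holomorphic functions on the unit disc. -/
def HolD : Type := holSubalgebra

namespace HolD

instance : CommRing HolD := inferInstanceAs (CommRing holSubalgebra)

instance : Algebra ℂ HolD := inferInstanceAs (Algebra ℂ holSubalgebra)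

instance : CoeFun HolD (fun _ => 𝔻 → ℂ) := ⟨fun f => f.1⟩

theorem diff (f : HolD) : DifferentiableOn ℂ (ext f) (Metric.ball 0 1) := f.2

theorem funext {f g : HolD} (h : ∀ z, f z = g z) : f = g := Subtype.ext (_root_.funext h)

theorem add_apply (f g : HolD) (z : 𝔻) : (f + g) z = f z + g z := rfl

theorem mul_apply (f g : HolD) (z : 𝔻) : (f * g) z = f z * g z := rfl

theorem smul_apply (c : ℂ) (f : HolD) (z : 𝔻) : (c • f) z = c * f z := rfl

theorem ext_add (f g : HolD) : ext (f + g : HolD) = fun z => ext f z + ext g z := by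
  funext z
  by_cases h : ‖z‖ < 1
  · simp only [ext_of_lt _ h, add_apply]
  · simp [ext, h]

theorem ext_smul (c : ℂ) (f : HolD) : ext (c • f : HolD) = fun z => c * ext f z := by
  funext z
  by_cases h : ‖z‖ < 1
  · simp only [ext_of_lt _ h, smul_apply]
  · simp [ext, h]

theorem contDiffAt (f : HolD) {z : ℂ} (hz : ‖z‖ < 1) (n : WithTop ℕ∞) :
    ContDiffAt ℂ n (ext f) z :=
  (f.diff.analyticAt (Metric.isOpen_ball.mem_nhds (by simpa using hz))).contDiffAt

/-- The `n`-th Taylor coefficient at `0`. -/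
def coeff (f : HolD) (n : ℕ) : ℂ := iteratedDeriv n (ext f) 0 / (n.factorial : ℂ)

theorem coeff_add (f g : HolD) (n : ℕ) : (f + g).coeff n = f.coeff n + g.coeff n := by
  unfold coeff
  rw [ext_add, iteratedDeriv_fun_add (f.contDiffAt (by simp) _) (g.contDiffAt (by simp) _),
    add_div]

theorem coeff_smul (c : ℂ) (f : HolD) (n : ℕ) : (c • f).coeff n = c * f.coeff n := by
  unfold coeff
  rw [ext_smul, iteratedDeriv_const_mul_field, mul_div_assoc]

theorem coeff_zero (n : ℕ) : (0 : HolD).coeff n = 0 := by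
  simpa using coeff_smul 0 0 n

theorem eq_zero_of_coeff (f : HolD) (h : ∀ n, f.coeff n = 0) : f = 0 := by
  refine funext fun z => ?_
  have h1 := Complex.taylorSeries_eq_on_ball' (z := z) (by simpa using z.norm_lt_one) f.diff
  have h2 : ∀ n, iteratedDeriv n (ext f) 0 = 0 := fun n => by
    have := h n
    unfold coeff at this
    rcases div_eq_zero_iff.1 this with h | h
    · exact h
    · exact absurd h (by exact_mod_cast n.factorial_ne_zero)
  rw [ext_coe] at h1
  simp only [h2] at h1
  change f z = 0
  simpa using h1.symm

end HolD

section Volterra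

/-- The integrand of `∫₀ᶻ f g'` along the segment from `0` to `z`, parametrized by `[0,1]`. -/
def integrand (g f : HolD) (z : ℂ) (t : ℝ) : ℂ :=
  z * (ext f ((t : ℂ) * z) * deriv (ext g) ((t : ℂ) * z))

theorem norm_seg {z : ℂ} (hz : ‖z‖ < 1) {t : ℝ} (ht : t ∈ Set.Icc (0 : ℝ) 1) :
    ‖(t : ℂ) * z‖ < 1 := by
  rw [norm_mul, Complex.norm_real, Real.norm_of_nonneg ht.1]
  nlinarith [ht.1, ht.2, norm_nonneg z]

theorem diff_fg (g f : HolD) :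
    DifferentiableOn ℂ (fun w => ext f w * deriv (ext g) w) (Metric.ball 0 1) :=
  f.diff.mul (g.diff.deriv Metric.isOpen_ball)

theorem integrand_intervalIntegrable (g f : HolD) {z : ℂ} (hz : ‖z‖ < 1) :
    IntervalIntegrable (integrand g f z) MeasureTheory.volume 0 1 := by
  apply ContinuousOn.intervalIntegrable
  rw [Set.uIcc_of_le zero_le_one]
  refine continuousOn_const.mul ?_
  refine (diff_fg g f).continuousOn.comp (f := fun t : ℝ => (t : ℂ) * z)
    (by fun_prop) fun t ht => ?_
  rw [mem_ball_zero_iff]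
  exact norm_seg hz ht

/-- The function `z ↦ ∫₀ᶻ f(t) g'(t) dt` on the disc. -/
def volterraFun (g f : HolD) (z : 𝔻) : ℂ := ∫ t in (0 : ℝ)..1, integrand g f z t

theorem volterraFun_eq_primitive (g f : HolD) {F : ℂ → ℂ} (h0 : F 0 = 0)
    (hF : ∀ w ∈ Metric.ball (0 : ℂ) 1, HasDerivAt F (ext f w * deriv (ext g) w) w) (z : 𝔻) :
    volterraFun g f z = F z := by
  have h := intervalIntegral.integral_eq_sub_of_hasDerivAt (a := 0) (b := 1)
    (f := fun t : ℝ => F ((t : ℂ) * z)) (f' := integrand g f z) (fun t ht => ?_)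
    (integrand_intervalIntegrable g f z.norm_lt_one)
  · simpa [h0, volterraFun] using h
  · rw [Set.uIcc_of_le zero_le_one] at ht
    have h1 := hF ((t : ℂ) * z) (by simpa using norm_seg z.norm_lt_one ht)
    have h2 : HasDerivAt (fun s : ℝ => (s : ℂ) * (z : ℂ)) (z : ℂ) t := by
      simpa using (Complex.ofRealCLM.hasDerivAt (x := t)).mul_const (z : ℂ)
    have h3 := h1.comp t h2
    rw [mul_comm] at h3
    exact h3

theorem volterraFun_mem (g f : HolD) : volterraFun g f ∈ holSubalgebra := by
  obtain ⟨F, h0, hF⟩ := (diff_fg g f).isExactOn_ball.with_val_at 0 0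
  refine DifferentiableOn.congr
    (fun w hw => (hF w hw).differentiableAt.differentiableWithinAt) fun z hz => ?_
  rw [mem_ball_zero_iff] at hz
  rw [ext_of_lt _ hz, volterraFun_eq_primitive g f h0 hF, Complex.UnitDisc.coe_mk]

/-- The generalized Volterra operator `T_g f (z) = ∫₀ᶻ f(t) g'(t) dt` on `H(𝔻)`, as a bilinear
map in `g` and `f`. -/
def volterra : HolD →ₗ[ℂ] HolD →ₗ[ℂ] HolD :=
  LinearMap.mk₂ ℂ (fun g f => ⟨volterraFun g f, volterraFun_mem g f⟩)
    (by
      intro g₁ g₂ f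
      refine HolD.funext fun z => ?_
      change volterraFun (g₁ + g₂) f z = volterraFun g₁ f z + volterraFun g₂ f z
      unfold volterraFun
      rw [← intervalIntegral.integral_add
        (integrand_intervalIntegrable _ _ z.norm_lt_one)
        (integrand_intervalIntegrable _ _ z.norm_lt_one)]
      refine intervalIntegral.integral_congr fun t ht => ?_
      rw [Set.uIcc_of_le zero_le_one] at ht
      have hz := norm_seg z.norm_lt_one ht
      simp only [integrand]
      rw [HolD.ext_add, deriv_fun_add
        ((g₁.contDiffAt hz 1).differentiableAt one_ne_zero)
        ((g₂.contDiffAt hz 1).differentiableAt one_ne_zero)]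
      ring)
    (by
      intro c g f
      refine HolD.funext fun z => ?_
      change volterraFun (c • g) f z = c * volterraFun g f z
      unfold volterraFun
      rw [← intervalIntegral.integral_const_mul]
      refine intervalIntegral.integral_congr fun t _ => ?_
      simp only [integrand]
      rw [HolD.ext_smul, deriv_const_mul_field]
      ring)
    (by
      intro g f₁ f₂
      refine HolD.funext fun z => ?_
      change volterraFun g (f₁ + f₂) z = volterraFun g f₁ z + volterraFun g f₂ z
      unfold volterraFun
      rw [← intervalIntegral.integral_add
        (integrand_intervalIntegrable _ _ z.norm_lt_one)
        (integrand_intervalIntegrable _ _ z.norm_lt_one)]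
      refine intervalIntegral.integral_congr fun t _ => ?_
      simp only [integrand]
      rw [HolD.ext_add]
      ring)
    (by
      intro c g f
      refine HolD.funext fun z => ?_
      change volterraFun g (c • f) z = c * volterraFun g f z
      unfold volterraFun
      rw [← intervalIntegral.integral_const_mul]
      refine intervalIntegral.integral_congr fun t _ => ?_
      simp only [integrand]
      rw [HolD.ext_smul]
      ring)

theorem volterra_apply (g f : HolD) (z : 𝔻) :
    volterra g f z =
      ∫ t in (0 : ℝ)..1, (z : ℂ) * (ext f ((t : ℂ) * z) * deriv (ext g) ((t : ℂ) * z)) := rfl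

end Volterra

/-- A positive weight sequence `ω = (ω₀, ω₁, …)`. -/
structure Weight where
  toFun : ℕ → ℝ
  pos : ∀ n, 0 < toFun n

instance : CoeFun Weight (fun _ => ℕ → ℝ) := ⟨Weight.toFun⟩

/-- The coefficient sequence of `f`, weighted so that its plain `p`-th power sum is
`∑ |f̂(n)|^p ω_n`. -/
def wcoeff (p : ℝ) (ω : Weight) (f : HolD) (n : ℕ) : ℂ :=
  f.coeff n * ((ω n ^ (1 / p) : ℝ) : ℂ)

theorem norm_wcoeff_rpow (p : ℝ) [hp : Fact (1 < p)] (ω : Weight) (f : HolD) (n : ℕ) :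
    ‖wcoeff p ω f n‖ ^ p = ‖f.coeff n‖ ^ p * ω n := by
  have h0 : (0 : ℝ) < p := zero_lt_one.trans hp.out
  have h1 := (ω.pos n).le
  rw [wcoeff, norm_mul, Complex.norm_real, Real.norm_of_nonneg (Real.rpow_nonneg h1 _),
    Real.mul_rpow (norm_nonneg _) (Real.rpow_nonneg h1 _), ← Real.rpow_mul h1,
    one_div_mul_cancel h0.ne', Real.rpow_one]

theorem toReal_ofReal (p : ℝ) [hp : Fact (1 < p)] : (ENNReal.ofReal p).toReal = p :=
  ENNReal.toReal_ofReal (zero_lt_one.trans hp.out).le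

theorem memℓp_wcoeff_iff (p : ℝ) [hp : Fact (1 < p)] (ω : Weight) (f : HolD) :
    Memℓp (wcoeff p ω f) (ENNReal.ofReal p) ↔
      Summable fun n => ‖f.coeff n‖ ^ p * ω n := by
  rw [memℓp_gen_iff (by rw [toReal_ofReal]; exact zero_lt_one.trans hp.out), toReal_ofReal]
  simp only [norm_wcoeff_rpow]

/-- The weighted space `ℓ^p_A(ω)` of all `f ∈ H(𝔻)` with `∑ |f̂(n)|^p ω_n < ∞`. -/
def LpA (p : ℝ) [Fact (1 < p)] (ω : Weight) : Submodule ℂ HolD where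
  carrier := {f | Summable fun n => ‖f.coeff n‖ ^ p * ω n}
  add_mem' := by
    intro f g hf hg
    rw [Set.mem_ofPred_eq, ← memℓp_wcoeff_iff] at hf hg ⊢
    have h := hf.add hg
    have e : wcoeff p ω (f + g) = wcoeff p ω f + wcoeff p ω g := by
      funext n
      simp [wcoeff, HolD.coeff_add, add_mul]
    rwa [e]
  zero_mem' := by
    have h0 : p ≠ 0 := (zero_lt_one.trans (Fact.out : 1 < p)).ne'
    simp [HolD.coeff_zero, Real.zero_rpow h0, summable_zero]
  smul_mem' := by
    intro c f hf
    rw [Set.mem_ofPred_eq, ← memℓp_wcoeff_iff] at hf ⊢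
    have h := hf.const_smul c
    have e : wcoeff p ω (c • f) = c • wcoeff p ω f := by
      funext n
      simp [wcoeff, HolD.coeff_smul, mul_assoc]
    rwa [e]

namespace LpA

/-- `‖f‖ = (∑ |f̂(n)|^p ω_n)^{1/p}`. -/
instance (p : ℝ) [Fact (1 < p)] (ω : Weight) : Norm (LpA p ω) :=
  ⟨fun f => (∑' n, ‖(f : HolD).coeff n‖ ^ p * ω n) ^ (1 / p)⟩

theorem norm_def (p : ℝ) [Fact (1 < p)] (ω : Weight) (f : LpA p ω) :
    ‖f‖ = (∑' n, ‖(f : HolD).coeff n‖ ^ p * ω n) ^ (1 / p) := rfl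

/-- The weighted coefficient sequence, as an element of the sequence space `ℓ^p`. -/
def toLp (p : ℝ) [Fact (1 < p)] (ω : Weight) (f : LpA p ω) :
    lp (fun _ : ℕ => ℂ) (ENNReal.ofReal p) :=
  ⟨wcoeff p ω f, (memℓp_wcoeff_iff p ω f).2 f.2⟩

theorem norm_toLp (p : ℝ) [hp : Fact (1 < p)] (ω : Weight) (f : LpA p ω) :
    ‖toLp p ω f‖ = ‖f‖ := by
  rw [lp.norm_eq_tsum_rpow (by rw [toReal_ofReal]; exact zero_lt_one.trans hp.out),
    toReal_ofReal, norm_def]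
  simp only [toLp, norm_wcoeff_rpow]

theorem toLp_add (p : ℝ) [Fact (1 < p)] (ω : Weight) (f g : LpA p ω) :
    toLp p ω (f + g) = toLp p ω f + toLp p ω g := by
  ext n
  change wcoeff p ω (f + g : HolD) n = wcoeff p ω f n + wcoeff p ω g n
  simp [wcoeff, HolD.coeff_add, add_mul]

theorem toLp_smul (p : ℝ) [Fact (1 < p)] (ω : Weight) (c : ℂ) (f : LpA p ω) :
    toLp p ω (c • f) = c • toLp p ω f := by
  ext n
  change wcoeff p ω (c • (f : HolD)) n = c * wcoeff p ω f n
  simp [wcoeff, HolD.coeff_smul, mul_assoc]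

theorem normCore (p : ℝ) [hp : Fact (1 < p)] (ω : Weight) :
    NormedSpace.Core ℂ (LpA p ω) := by
  have : Fact (1 ≤ ENNReal.ofReal p) := ⟨by simpa using hp.out.le⟩
  refine ⟨⟨fun f => ?_, fun c f => ?_, fun f g => ?_⟩, fun f => ⟨fun h => ?_, ?_⟩⟩
  · rw [← norm_toLp]; exact norm_nonneg _
  · rw [← norm_toLp, ← norm_toLp, toLp_smul, norm_smul]
  · rw [← norm_toLp, ← norm_toLp, ← norm_toLp, toLp_add]; exact norm_add_le _ _
  · rw [← norm_toLp, norm_eq_zero] at h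
    refine Subtype.ext (HolD.eq_zero_of_coeff _ fun n => ?_)
    have h1 : wcoeff p ω f n = 0 := congrFun (congrArg Subtype.val h) n
    have h2 : ((ω n ^ (1 / p) : ℝ) : ℂ) ≠ 0 := by
      exact_mod_cast (Real.rpow_pos_of_pos (ω.pos n) _).ne'
    exact (mul_eq_zero.1 h1).resolve_right h2
  · rintro rfl
    have h := toLp_smul p ω 0 0
    rw [zero_smul, zero_smul] at h
    rw [← norm_toLp, h, norm_zero]

instance (p : ℝ) [Fact (1 < p)] (ω : Weight) : NormedAddCommGroup (LpA p ω) :=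
  NormedAddCommGroup.ofCore (normCore p ω)

instance (p : ℝ) [Fact (1 < p)] (ω : Weight) : NormedSpace ℂ (LpA p ω) :=
  NormedSpace.ofCore (normCore p ω)

end LpA

/-- The multiplier algebra of `ℓ^p_A(ω)`: all `g ∈ H(𝔻)` with `g f ∈ ℓ^p_A(ω)` for every
`f ∈ ℓ^p_A(ω)`. -/
def Mult (p : ℝ) [Fact (1 < p)] (ω : Weight) : Subalgebra ℂ HolD where
  carrier := {g | ∀ f ∈ LpA p ω, g * f ∈ LpA p ω}
  mul_mem' := by
    intro g h hg hh f hf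
    rw [mul_assoc]
    exact hg _ (hh f hf)
  add_mem' := by
    intro g h hg hh f hf
    rw [add_mul]
    exact (LpA p ω).add_mem (hg f hf) (hh f hf)
  algebraMap_mem' := by
    intro c f hf
    rw [← Algebra.smul_def]
    exact (LpA p ω).smul_mem c hf

/-- The space `T(ℓ^p_A(ω))` of all `g ∈ H(𝔻)` such that `T_g` maps `ℓ^p_A(ω)` boundedly into
itself. -/
def VolterraSymbols (p : ℝ) [Fact (1 < p)] (ω : Weight) : Submodule ℂ HolD where
  carrier := {g | ∃ C : ℝ, ∀ f : LpA p ω, ∃ h : volterra g f ∈ LpA p ω,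
    ‖(⟨volterra g f, h⟩ : LpA p ω)‖ ≤ C * ‖f‖}
  add_mem' := by
    rintro g₁ g₂ ⟨C₁, h₁⟩ ⟨C₂, h₂⟩
    refine ⟨C₁ + C₂, fun f => ?_⟩
    obtain ⟨m₁, b₁⟩ := h₁ f
    obtain ⟨m₂, b₂⟩ := h₂ f
    have e : volterra (g₁ + g₂) f = volterra g₁ f + volterra g₂ f := by
      rw [map_add, LinearMap.add_apply]
    have m' : volterra (g₁ + g₂) f ∈ LpA p ω := by rw [e]; exact (LpA p ω).add_mem m₁ m₂
    refine ⟨m', ?_⟩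
    have e' : (⟨volterra (g₁ + g₂) f, m'⟩ : LpA p ω) =
        ⟨volterra g₁ f, m₁⟩ + ⟨volterra g₂ f, m₂⟩ := Subtype.ext e
    rw [e', add_mul]
    exact (norm_add_le _ _).trans (add_le_add b₁ b₂)
  zero_mem' := by
    refine ⟨0, fun f => ?_⟩
    have e : volterra 0 f = 0 := by rw [map_zero, LinearMap.zero_apply]
    have m : volterra 0 f ∈ LpA p ω := by rw [e]; exact (LpA p ω).zero_mem
    refine ⟨m, ?_⟩
    have e' : (⟨volterra 0 f, m⟩ : LpA p ω) = 0 := Subtype.ext e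
    rw [e', norm_zero, zero_mul]
  smul_mem' := by
    rintro c g ⟨C, h⟩
    refine ⟨‖c‖ * C, fun f => ?_⟩
    obtain ⟨m, b⟩ := h f
    have e : volterra (c • g) f = c • volterra g f := by
      rw [map_smul, LinearMap.smul_apply]
    have m' : volterra (c • g) f ∈ LpA p ω := by rw [e]; exact (LpA p ω).smul_mem c m
    refine ⟨m', ?_⟩
    have e' : (⟨volterra (c • g) f, m'⟩ : LpA p ω) =
        c • ⟨volterra g f, m⟩ := Subtype.ext e
    rw [e', norm_smul, mul_assoc]
    exact mul_le_mul_of_nonneg_left b (norm_nonneg c)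

/-- The bounded operator `T_g` on `ℓ^p_A(ω)` for `g ∈ T(ℓ^p_A(ω))`, linearly in `g`. -/
def volterraOp (p : ℝ) [Fact (1 < p)] (ω : Weight) :
    VolterraSymbols p ω →ₗ[ℂ] (LpA p ω →L[ℂ] LpA p ω) where
  toFun g :=
    LinearMap.mkContinuousOfExistsBound
      ((volterra (g : HolD)).restrict fun f hf => (g.2.choose_spec ⟨f, hf⟩).choose)
      ⟨g.2.choose, fun f => (g.2.choose_spec f).choose_spec⟩
  map_add' g₁ g₂ := by
    refine ContinuousLinearMap.ext fun f => Subtype.ext ?_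
    change volterra ((g₁ : HolD) + g₂) f = volterra g₁ f + volterra g₂ f
    rw [map_add, LinearMap.add_apply]
  map_smul' c g := by
    refine ContinuousLinearMap.ext fun f => Subtype.ext ?_
    change volterra (c • (g : HolD)) f = c • volterra g f
    rw [map_smul, LinearMap.smul_apply]

theorem coe_volterraOp (p : ℝ) [Fact (1 < p)] (ω : Weight) (g : VolterraSymbols p ω)
    (f : LpA p ω) : (volterraOp p ω g f : HolD) = volterra g f := rfl

/-- The seminorm `‖g‖ = ‖T_g‖` on `T(ℓ^p_A(ω))` (it vanishes on the constants). -/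
instance (p : ℝ) [Fact (1 < p)] (ω : Weight) :
    SeminormedAddCommGroup (VolterraSymbols p ω) :=
  SeminormedAddCommGroup.induced _ _ (volterraOp p ω)

theorem norm_symbol (p : ℝ) [Fact (1 < p)] (ω : Weight) (g : VolterraSymbols p ω) :
    ‖g‖ = ‖volterraOp p ω g‖ := rfl

end VolterraLp
end

/-! For `g` in `Mult`, multiplication `M_g` is bounded by the closed graph theorem. Its matrix in
weighted coefficients is lower triangular, with entries `a n k`. From `n (T_g f)^(n) = ∑ (n - k) ĝ(n
- k) f̂(k)` one reads `T_g = M_g - B`, where for `n > 0` the entries of `B` are `(k / n) a n k`. So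
the inclusion follows once multiplying the entries of a lower triangular matrix by `k / n` is a
contraction for the operator norm (`exists_norm_le_of_lowerTriangular`). The factor telescopes, `k /
n = ∏ j / (j + 1)` over `k ≤ j < n`, and each single factor comes from averaging the operator with
its conjugate by a diagonal sign isometry.

For the spectrum, let `c ≠ 0` and choose `h` in `Mult` with `‖T_{g-h}‖ < |c|`. Comparison of Taylor
coefficients shows that `c - T_g` is injective. To solve `c f - T_g f = F`, substitute `f = e^{h/c}
u`. After differentiation the equation becomes `c u' - u (g - h)' = e^{-h/c} F'`, which integrates
to `c u - T_{g-h} u = e^{-h/c} F - T_{e^{-h/c}} F`. Both exponentials lie in `Mult`, hence also in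
`T(ℓ^p_A(ω))` by the inclusion, so the right side is in the space, and `c - T_{g-h}` is inverted by
a Neumann series. -/

noncomputable section

namespace VolterraLp

/-! ### Holomorphic functions on the disc: derivative, Taylor coefficients, exponential. -/

namespace HolD

/-- The restriction to the disc of a function holomorphic there. -/
def ofDiff (F : ℂ → ℂ) (hF : DifferentiableOn ℂ F (Metric.ball 0 1)) : HolD :=
  ⟨fun z => F z, hF.congr fun z hz => by
    rw [mem_ball_zero_iff] at hz
    rw [ext_of_lt _ hz, Complex.UnitDisc.coe_mk]⟩

theorem ofDiff_apply (F : ℂ → ℂ) (hF : DifferentiableOn ℂ F (Metric.ball 0 1)) (z : 𝔻) :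
    ofDiff F hF z = F z := rfl

theorem ext_ofDiff (F : ℂ → ℂ) (hF : DifferentiableOn ℂ F (Metric.ball 0 1)) {z : ℂ}
    (hz : ‖z‖ < 1) : ext (ofDiff F hF) z = F z := by
  rw [ext_of_lt _ hz, ofDiff_apply, Complex.UnitDisc.coe_mk]

theorem ext_mul (f g : HolD) : ext (f * g : HolD) = fun z => ext f z * ext g z := by
  funext z
  by_cases h : ‖z‖ < 1
  · simp only [ext_of_lt _ h, mul_apply]
  · simp [ext, h]

theorem ball_mem_nhds {z : ℂ} (hz : ‖z‖ < 1) : Metric.ball (0 : ℂ) 1 ∈ 𝓝 z :=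
  Metric.isOpen_ball.mem_nhds (by simpa using hz)

theorem differentiableAt (f : HolD) {z : ℂ} (hz : ‖z‖ < 1) : DifferentiableAt ℂ (ext f) z :=
  f.diff.differentiableAt (ball_mem_nhds hz)

theorem ext_ofDiff_eventuallyEq (F : ℂ → ℂ) (hF : DifferentiableOn ℂ F (Metric.ball 0 1)) {z : ℂ}
    (hz : ‖z‖ < 1) : ext (ofDiff F hF) =ᶠ[𝓝 z] F := by
  filter_upwards [ball_mem_nhds hz] with w hw
  exact ext_ofDiff F hF (by simpa using hw)

/-- Differentiation on `H(𝔻)`. -/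
def derivation : Derivation ℂ HolD HolD :=
  Derivation.mk'
    { toFun := fun f => ofDiff (deriv (ext f)) (f.diff.deriv Metric.isOpen_ball)
      map_add' := fun f g => HolD.funext fun z => by
        rw [add_apply]
        simp only [ofDiff_apply]
        rw [ext_add, deriv_fun_add (f.differentiableAt z.norm_lt_one)
          (g.differentiableAt z.norm_lt_one)]
      map_smul' := fun c f => HolD.funext fun z => by
        rw [RingHom.id_apply, smul_apply]
        simp only [ofDiff_apply]
        rw [ext_smul, deriv_const_mul_field] }
    (fun f g => HolD.funext fun z => by
      simp only [LinearMap.coe_mk, AddHom.coe_mk, smul_eq_mul, add_apply, mul_apply, ofDiff_apply]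
      rw [ext_mul, deriv_fun_mul (f.differentiableAt z.norm_lt_one)
        (g.differentiableAt z.norm_lt_one), ext_coe, ext_coe]
      ring)

theorem derivation_apply (f : HolD) (z : 𝔻) : derivation f z = deriv (ext f) z := rfl

theorem derivation_mul (f g : HolD) :
    derivation (f * g) = f * derivation g + g * derivation f := derivation.leibniz f g

theorem coeff_derivation (f : HolD) (n : ℕ) :
    (derivation f).coeff n = (n + 1) * f.coeff (n + 1) := by
  have h : ext (derivation f) =ᶠ[𝓝 0] deriv (ext f) :=
    ext_ofDiff_eventuallyEq _ (f.diff.deriv Metric.isOpen_ball) (by simp)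
  have hn : (n.factorial : ℂ) ≠ 0 := by exact_mod_cast n.factorial_ne_zero
  have hn' : (n : ℂ) + 1 ≠ 0 := by exact_mod_cast n.succ_ne_zero
  unfold coeff
  rw [h.iteratedDeriv_eq, iteratedDeriv_succ', Nat.factorial_succ]
  push_cast
  field_simp

theorem coeff_zero_eq (f : HolD) : f.coeff 0 = f 0 := by
  rw [← ext_coe f 0]
  simp [coeff]

theorem coeff_mul (f g : HolD) (n : ℕ) :
    (f * g).coeff n = ∑ k ∈ Finset.range (n + 1), f.coeff k * g.coeff (n - k) := by
  unfold coeff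
  rw [ext_mul, iteratedDeriv_fun_mul (f.contDiffAt (by simp) _) (g.contDiffAt (by simp) _),
    Finset.sum_div]
  refine Finset.sum_congr rfl fun k hk => ?_
  have hk' : k ≤ n := by simpa [Nat.lt_succ_iff] using hk
  have h0 (m : ℕ) : (m.factorial : ℂ) ≠ 0 := by exact_mod_cast m.factorial_ne_zero
  rw [Nat.cast_choose ℂ hk']
  have h1 := h0 k
  have h2 := h0 n
  have h3 := h0 (n - k)
  field_simp

theorem ext_coeff {f g : HolD} (h : ∀ n, f.coeff n = g.coeff n) : f = g := by
  rw [← sub_eq_zero]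
  refine eq_zero_of_coeff _ fun n => ?_
  rw [sub_eq_add_neg, ← neg_one_smul ℂ g, coeff_add, coeff_smul, h]
  ring

/-- Reduces an identity between Volterra integrals to algebra: differentiation removes the integral,
and the value at `0` fixes the constant. -/
theorem eq_of_derivation_eq {f g : HolD} (h : derivation f = derivation g) (h0 : f 0 = g 0) :
    f = g := by
  refine ext_coeff fun n => ?_
  cases n with
  | zero => rw [coeff_zero_eq, coeff_zero_eq, h0]
  | succ n =>
    have h1 := congrArg (fun f => coeff f n) h
    simp only [coeff_derivation] at h1
    exact mul_left_cancel₀ (by exact_mod_cast n.succ_ne_zero) h1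

theorem hasSum_coeff (f : HolD) (z : 𝔻) : HasSum (fun n => f.coeff n * (z : ℂ) ^ n) (f z) := by
  have h := Complex.hasSum_taylorSeries_on_ball (c := 0) (r := 1) (f := ext f) (z := z)
    (by simpa using f.diff) (by simpa using z.norm_lt_one)
  rw [ext_coe] at h
  refine h.congr_fun fun n => ?_
  rw [coeff, sub_zero, smul_eq_mul, smul_eq_mul]
  ring

/-- The holomorphic function with prescribed Taylor coefficients. -/
theorem exists_coeff_eq (a : ℕ → ℂ)
    (ha : ∀ r : ℝ, 0 < r → r < 1 → Summable fun n => ‖a n‖ * r ^ n) :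
    ∃ f : HolD, ∀ n, f.coeff n = a n := by
  let P := FormalMultilinearSeries.ofScalars ℂ a
  have hP : 1 ≤ P.radius := by
    refine le_of_forall_lt_imp_le_of_dense fun r hr => ?_
    lift r to NNReal using hr.ne_top
    rcases eq_zero_or_pos r with rfl | h0
    · simp
    refine P.le_radius_of_summable ?_
    simpa [P] using ha r (by exact_mod_cast h0) (by exact_mod_cast hr)
  have hb := P.hasFPowerSeriesOnBall (zero_lt_one.trans_le hP)
  have hd : DifferentiableOn ℂ P.sum (Metric.ball 0 1) := by
    refine hb.differentiableOn.mono fun z hz => ?_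
    rw [← Metric.eball_ofReal] at hz
    exact Metric.eball_subset_eball (by simpa using hP) hz
  refine ⟨ofDiff P.sum hd, fun n => ?_⟩
  have he := ext_ofDiff_eventuallyEq P.sum hd (z := 0) (by simp)
  unfold coeff
  rw [he.iteratedDeriv_eq]
  -- `P` and the Taylor series both expand `P.sum` at `0`, and a power series expansion is unique.
  have h1 := hb.hasFPowerSeriesAt.eq_formalMultilinearSeries hb.analyticAt.hasFPowerSeriesAt
  exact (congrFun (FormalMultilinearSeries.ofScalars_series_injective ℂ ℂ h1) n).symm

/-- The exponential of a holomorphic function. -/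
def exp (f : HolD) : HolD := ofDiff (fun z => Complex.exp (ext f z)) f.diff.cexp

theorem exp_apply (f : HolD) (z : 𝔻) : exp f z = Complex.exp (f z) := by
  rw [exp, ofDiff_apply, ext_coe]

theorem derivation_exp (f : HolD) : derivation (exp f) = exp f * derivation f := by
  refine HolD.funext fun z => ?_
  rw [mul_apply, derivation_apply, derivation_apply, exp,
    (ext_ofDiff_eventuallyEq _ f.diff.cexp z.norm_lt_one).deriv_eq,
    deriv_cexp (f.differentiableAt z.norm_lt_one), ofDiff_apply]

theorem exp_mul_exp_neg (f : HolD) : exp f * exp (-f) = 1 := by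
  refine HolD.funext fun z => ?_
  change exp f z * exp (-f) z = 1
  rw [exp_apply, exp_apply]
  change Complex.exp (f z) * Complex.exp (-(f z)) = 1
  rw [← Complex.exp_add, add_neg_cancel, Complex.exp_zero]

end HolD

open HolD

/-! ### The Volterra operator via derivatives and coefficients. -/

theorem volterra_apply_zero (g f : HolD) : volterra g f 0 = 0 := by
  rw [volterra_apply]
  simp

/-- The segment integral agrees with the primitive of `f g'` that vanishes at `0`, which exists on
the disc. -/
theorem derivation_volterra (g f : HolD) : derivation (volterra g f) = f * derivation g := by
  obtain ⟨F, h0, hF⟩ := (diff_fg g f).isExactOn_ball.with_val_at 0 0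
  have hd : DifferentiableOn ℂ F (Metric.ball 0 1) :=
    fun w hw => (hF w hw).differentiableAt.differentiableWithinAt
  have he : volterra g f = ofDiff F hd :=
    HolD.funext fun z => volterraFun_eq_primitive g f h0 hF z
  refine HolD.funext fun z => ?_
  rw [mul_apply, derivation_apply, derivation_apply, he,
    (ext_ofDiff_eventuallyEq F hd z.norm_lt_one).deriv_eq,
    (hF z (by simpa using z.norm_lt_one)).deriv, ext_coe]

theorem coeff_volterra_zero (g f : HolD) : (volterra g f).coeff 0 = 0 := by
  rw [coeff_zero_eq, volterra_apply_zero]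

/-- The factor `n` on the left avoids a division and admits `n = 0`. The vanishing term `k = n` is
kept so that the sum matches the Cauchy product of `coeff_mul`. -/
theorem coeff_volterra (g f : HolD) (n : ℕ) :
    n * (volterra g f).coeff n =
      ∑ k ∈ Finset.range (n + 1), (n - k : ℂ) * (f.coeff k * g.coeff (n - k)) := by
  cases n with
  | zero => simp
  | succ n =>
    push_cast
    rw [← coeff_derivation, derivation_volterra, coeff_mul, Finset.sum_range_succ _ (n + 1)]
    push_cast
    rw [sub_self, zero_mul, add_zero]
    refine Finset.sum_congr rfl fun k hk => ?_
    have hk' : k ≤ n := by simpa [Nat.lt_succ_iff] using hk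
    rw [coeff_derivation, Nat.cast_sub hk', Nat.succ_sub hk', Nat.succ_eq_add_one]
    ring

/-! ### The Banach space `ℓ^p_A(ω)`. -/

instance fact_one_le_ofReal (p : ℝ) [hp : Fact (1 < p)] : Fact (1 ≤ ENNReal.ofReal p) :=
  ⟨by simpa using hp.out.le⟩

variable {p : ℝ} [hp : Fact (1 < p)] {ω : Weight}

theorem weight_rpow_pos (p : ℝ) (ω : Weight) (n : ℕ) : 0 < ω n ^ (1 / p) :=
  Real.rpow_pos_of_pos (ω.pos n) _

/-- Ratio test: consecutive terms have ratio `(ω n / ω (n + 1)) ^ (1 / p) * r`, which tends to `r`.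
The hypothesis on the weights acts only through this lemma. -/
theorem summable_inv_weight (p : ℝ) [Fact (1 < p)] {ω : Weight}
    (hω : Tendsto (fun n => ω n / ω (n + 1)) atTop (𝓝 1)) {r : ℝ} (h0 : 0 < r) (h1 : r < 1) :
    Summable fun n => (ω n ^ (1 / p))⁻¹ * r ^ n := by
  have hpos : ∀ n, 0 < (ω n ^ (1 / p))⁻¹ * r ^ n := fun n =>
    mul_pos (inv_pos.2 (weight_rpow_pos p ω n)) (pow_pos h0 n)
  refine summable_of_ratio_test_tendsto_lt_one h1 (Eventually.of_forall fun n => (hpos n).ne') ?_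
  have h2 : Tendsto (fun n => (ω n / ω (n + 1)) ^ (1 / p) * r) atTop (𝓝 r) := by
    have h := (hω.rpow_const (p := 1 / p) (Or.inl one_ne_zero)).mul_const r
    rwa [Real.one_rpow, one_mul] at h
  refine h2.congr fun n => ?_
  rw [Real.norm_of_nonneg (hpos n).le, Real.norm_of_nonneg (hpos _).le,
    Real.div_rpow (ω.pos _).le (ω.pos _).le]
  have e1 := (weight_rpow_pos p ω n).ne'
  have e2 := (weight_rpow_pos p ω (n + 1)).ne'
  field_simp
  ring

namespace LpA

theorem norm_coeff_mul_le (f : LpA p ω) (n : ℕ) :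
    ‖(f : HolD).coeff n‖ * ω n ^ (1 / p) ≤ ‖f‖ := by
  rw [← norm_toLp]
  have h0 : ENNReal.ofReal p ≠ 0 := by simpa using zero_lt_one.trans hp.out
  refine le_trans (le_of_eq ?_) (lp.norm_apply_le_norm h0 (toLp p ω f) n)
  change _ = ‖(f : HolD).coeff n * ((ω n ^ (1 / p) : ℝ) : ℂ)‖
  rw [norm_mul, Complex.norm_real, Real.norm_of_nonneg (weight_rpow_pos p ω n).le]

/-- The entries of `v` are bounded, so dividing them by the weights gives a power series that
converges on the whole disc. Completeness of `ℓ^p_A(ω)` rests on this. -/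
theorem toLp_surjective (hω : Tendsto (fun n => ω n / ω (n + 1)) atTop (𝓝 1)) :
    Function.Surjective (toLp p ω) := by
  intro v
  have h0 : ENNReal.ofReal p ≠ 0 := by simpa using zero_lt_one.trans hp.out
  obtain ⟨f, hf⟩ := exists_coeff_eq (fun n => v n * (((ω n ^ (1 / p))⁻¹ : ℝ) : ℂ))
    fun r h0r h1r => by
      refine Summable.of_nonneg_of_le (fun n => by positivity) (fun n => ?_)
        ((summable_inv_weight p hω h0r h1r).mul_left ‖v‖)
      rw [norm_mul, Complex.norm_real, Real.norm_of_nonneg (inv_pos.2 (weight_rpow_pos p ω n)).le,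
        mul_assoc]
      refine mul_le_mul_of_nonneg_right (lp.norm_apply_le_norm h0 v n) ?_
      exact mul_nonneg (inv_pos.2 (weight_rpow_pos p ω n)).le (pow_nonneg h0r.le n)
  have hw : wcoeff p ω f = v := by
    funext n
    rw [wcoeff, hf, mul_assoc, ← Complex.ofReal_mul,
      inv_mul_cancel₀ (weight_rpow_pos p ω n).ne', Complex.ofReal_one, mul_one]
  refine ⟨⟨f, (memℓp_wcoeff_iff p ω f).1 ?_⟩, ?_⟩
  · rw [hw]
    exact v.2
  · ext n
    exact congrFun hw n

/-- `ℓ^p_A(ω)` is isometrically isomorphic to the sequence space `ℓ^p`. -/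
def toLpEquiv (hω : Tendsto (fun n => ω n / ω (n + 1)) atTop (𝓝 1)) :
    LpA p ω ≃ₗᵢ[ℂ] lp (fun _ : ℕ => ℂ) (ENNReal.ofReal p) :=
  LinearIsometryEquiv.ofSurjective
    { toFun := toLp p ω
      map_add' := toLp_add p ω
      map_smul' := toLp_smul p ω
      norm_map' := norm_toLp p ω }
    (toLp_surjective hω)

theorem toLpEquiv_apply (hω : Tendsto (fun n => ω n / ω (n + 1)) atTop (𝓝 1)) (f : LpA p ω)
    (n : ℕ) : toLpEquiv hω f n = (f : HolD).coeff n * ((ω n ^ (1 / p) : ℝ) : ℂ) := rfl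

theorem completeSpace (hω : Tendsto (fun n => ω n / ω (n + 1)) atTop (𝓝 1)) :
    CompleteSpace (LpA p ω) :=
  (completeSpace_congr (e := (toLpEquiv (p := p) hω).toEquiv)
    (toLpEquiv hω).isometry.isUniformEmbedding).2 inferInstance

/-- Point evaluations are continuous on `ℓ^p_A(ω)`. -/
theorem continuous_eval (hω : Tendsto (fun n => ω n / ω (n + 1)) atTop (𝓝 1)) (z : 𝔻) :
    Continuous fun f : LpA p ω => (f : HolD) z := by
  obtain ⟨r, hr, hr1⟩ := exists_between z.norm_lt_one
  have hr0 : 0 < r := (norm_nonneg _).trans_lt hr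
  have hs := summable_inv_weight p hω hr0 hr1
  let L : LpA p ω →ₗ[ℂ] ℂ :=
    { toFun := fun f => (f : HolD) z
      map_add' := fun _ _ => rfl
      map_smul' := fun _ _ => rfl }
  refine (L.mkContinuous (∑' n, (ω n ^ (1 / p))⁻¹ * r ^ n) fun f => ?_).continuous
  change ‖(f : HolD) z‖ ≤ _
  rw [← (hasSum_coeff (f : HolD) z).tsum_eq]
  refine tsum_of_norm_bounded (hs.hasSum.mul_right ‖f‖) fun n => ?_
  have hw := weight_rpow_pos p ω n
  rw [norm_mul, norm_pow]
  calc ‖(f : HolD).coeff n‖ * ‖(z : ℂ)‖ ^ n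
      ≤ ‖(f : HolD).coeff n‖ * r ^ n := by gcongr
    _ = (ω n ^ (1 / p))⁻¹ * r ^ n * (‖(f : HolD).coeff n‖ * ω n ^ (1 / p)) := by field_simp
    _ ≤ (ω n ^ (1 / p))⁻¹ * r ^ n * ‖f‖ := by
      gcongr
      exact norm_coeff_mul_le f n

theorem one_mem : (1 : HolD) ∈ LpA p ω := by
  refine summable_of_ne_finset_zero (s := {0}) fun n hn => ?_
  obtain ⟨m, rfl⟩ := Nat.exists_eq_succ_of_ne_zero (by simpa using hn)
  -- The higher coefficients of `1` vanish because its derivative does.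
  have h := coeff_derivation 1 m
  rw [Derivation.map_one_eq_zero, coeff_zero] at h
  have h1 := (mul_eq_zero.1 h.symm).resolve_left (by exact_mod_cast m.succ_ne_zero)
  rw [Nat.succ_eq_add_one, h1, norm_zero, Real.zero_rpow (zero_lt_one.trans hp.out).ne', zero_mul]

/-- Needed for the spectrum to be nonempty. -/
instance : Nontrivial (LpA p ω) :=
  ⟨⟨⟨1, one_mem⟩, 0, fun h => by
    have h1 : (1 : HolD) 0 = (0 : HolD) 0 := congrArg (fun f : LpA p ω => (f : HolD) 0) h
    exact one_ne_zero h1⟩⟩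

end LpA

/-! ### Multiplication operators. -/

/-- The bounded operator of multiplication by `g ∈ Mult(ℓ^p_A(ω))`. -/
def mulOp (hω : Tendsto (fun n => ω n / ω (n + 1)) atTop (𝓝 1)) {g : HolD} (hg : g ∈ Mult p ω) :
    LpA p ω →L[ℂ] LpA p ω :=
  haveI := LpA.completeSpace (p := p) hω
  ContinuousLinearMap.ofSeqClosedGraph
    (g := (LinearMap.mulLeft ℂ g).restrict (p := LpA p ω) (q := LpA p ω) hg)
    -- The graph is closed because norm limits are also pointwise limits.
    fun u x y hu hv => Subtype.ext <| HolD.funext fun z => by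
      have h1 := ((LpA.continuous_eval hω z).tendsto x).comp hu
      have h2 := ((LpA.continuous_eval hω z).tendsto y).comp hv
      exact tendsto_nhds_unique h2 (h1.const_mul (g z))

theorem coe_mulOp (hω : Tendsto (fun n => ω n / ω (n + 1)) atTop (𝓝 1)) {g : HolD}
    (hg : g ∈ Mult p ω) (f : LpA p ω) : (mulOp hω hg f : HolD) = g * f := rfl

/-! ### The Schur multiplier `k / n` on lower triangular matrices. -/

section SchurMultiplier

variable {q : ENNReal} [hq : Fact (1 ≤ q)]

/-- The isometry of `ℓ^q` changing the sign of all coordinates beyond `m`. -/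
def signFlip (q : ENNReal) [hq : Fact (1 ≤ q)] (m : ℕ) :
    lp (fun _ : ℕ => ℂ) q →L[ℂ] lp (fun _ : ℕ => ℂ) q :=
  LinearMap.mkContinuous
    { toFun := fun v => ⟨fun n => (if n ≤ m then 1 else -1) * v n,
        (lp.memℓp v).mono' fun n => by split_ifs <;> simp⟩
      map_add' := fun v w => by
        ext n
        exact mul_add _ _ _
      map_smul' := fun c v => by
        ext n
        exact mul_left_comm _ _ _ }
    1 fun v => by
      rw [one_mul]
      refine lp.norm_mono (zero_lt_one.trans_le hq.out).ne' fun n => ?_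
      change ‖(if n ≤ m then 1 else -1) * v n‖ ≤ ‖v n‖
      split_ifs <;> simp

theorem signFlip_apply (m : ℕ) (v : lp (fun _ : ℕ => ℂ) q) (n : ℕ) :
    signFlip q m v n = (if n ≤ m then 1 else -1) * v n := rfl

theorem norm_signFlip_le (m : ℕ) : ‖signFlip q m‖ ≤ 1 :=
  LinearMap.mkContinuous_norm_le _ zero_le_one _

/-- Iterated averages of an operator over its conjugates by the isometries `signFlip q j`,
`j < m`. -/
def signAverage (A : lp (fun _ : ℕ => ℂ) q →L[ℂ] lp (fun _ : ℕ => ℂ) q) :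
    ℕ → lp (fun _ : ℕ => ℂ) q →L[ℂ] lp (fun _ : ℕ => ℂ) q
  | 0 => A
  -- Conjugation negates the lower triangular entries with `k ≤ m < n` and fixes the others, so
  -- those are scaled by `1 - 2 / (2 (m + 1)) = m / (m + 1)`.
  | m + 1 => (1 - (1 / (2 * (m + 1)) : ℝ)) • signAverage A m +
      (1 / (2 * (m + 1)) : ℝ) • (signFlip q m ∘L signAverage A m ∘L signFlip q m)

/-- Each stage is a convex combination of the previous one and its conjugate by a contraction. -/
theorem norm_signAverage_le (A : lp (fun _ : ℕ => ℂ) q →L[ℂ] lp (fun _ : ℕ => ℂ) q) (m : ℕ) :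
    ‖signAverage A m‖ ≤ ‖A‖ := by
  induction m with
  | zero => exact le_rfl
  | succ m ih =>
    have h0 : (0 : ℝ) ≤ 1 / (2 * (m + 1)) := by positivity
    have h1 : (0 : ℝ) ≤ 1 - 1 / (2 * (m + 1)) := by
      rw [sub_nonneg, div_le_one (by positivity)]
      linarith [(Nat.cast_nonneg m : (0 : ℝ) ≤ m)]
    have hS := norm_signFlip_le (q := q) m
    have h2 : ‖signFlip q m ∘L signAverage A m ∘L signFlip q m‖ ≤ ‖A‖ :=
      calc _ ≤ ‖signFlip q m‖ * ‖signAverage A m ∘L signFlip q m‖ :=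
            ContinuousLinearMap.opNorm_comp_le _ _
        _ ≤ ‖signFlip q m‖ * (‖signAverage A m‖ * ‖signFlip q m‖) := by
            gcongr
            exact ContinuousLinearMap.opNorm_comp_le _ _
        _ ≤ 1 * (‖A‖ * 1) := by gcongr
        _ = ‖A‖ := by ring
    calc ‖signAverage A (m + 1)‖
        ≤ (1 - 1 / (2 * (m + 1))) * ‖A‖ + 1 / (2 * (m + 1)) * ‖A‖ := by
          refine (norm_add_le _ _).trans ?_
          rw [norm_smul, norm_smul, Real.norm_of_nonneg h0, Real.norm_of_nonneg h1]
          gcongr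
      _ = ‖A‖ := by ring

/-- The factor by which `signAverage A m` changes the `(n, k)` matrix entry of a lower triangular
operator `A`. -/
def signWeight (m n k : ℕ) : ℝ :=
  ∏ j ∈ Finset.range m, if k ≤ j ∧ j < n then (j / (j + 1) : ℝ) else 1

theorem signWeight_succ (m n k : ℕ) : signWeight (m + 1) n k =
    signWeight m n k * if k ≤ m ∧ m < n then (m / (m + 1) : ℝ) else 1 :=
  Finset.prod_range_succ _ _

theorem signWeight_of_le {m k : ℕ} (n : ℕ) (h : m ≤ k) : signWeight m n k = 1 :=
  Finset.prod_eq_one fun j hj => if_neg fun hk => by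
    have := Finset.mem_range.1 hj
    omega

/-- The product of `j / (j + 1)` over `k ≤ j < min m n` telescopes to `k / min m n`. The form
without division also covers `min m n = 0`. -/
theorem min_mul_signWeight {n k : ℕ} (hk : k ≤ n) (m : ℕ) (hm : k ≤ m) :
    (min m n : ℕ) * signWeight m n k = k := by
  induction m, hm using Nat.le_induction with
  | base => rw [signWeight_of_le n le_rfl, min_eq_left hk, mul_one]
  | succ m hm ih =>
    rw [signWeight_succ]
    by_cases hmn : m < n
    · rw [min_eq_left hmn.le] at ih
      rw [if_pos ⟨hm, hmn⟩, min_eq_left hmn, ← ih]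
      push_cast
      have : (m : ℝ) + 1 ≠ 0 := by positivity
      field_simp
    · rw [if_neg (by omega), mul_one, min_eq_right (by omega), ← ih, min_eq_right (by omega)]

/-- For `k ≤ n` the two signs in the conjugation differ exactly when `k ≤ m < n`, which is the
condition in `signWeight`. -/
theorem signAverage_apply {A : lp (fun _ : ℕ => ℂ) q →L[ℂ] lp (fun _ : ℕ => ℂ) q}
    {a : ℕ → ℕ → ℂ} (hA : ∀ v n, A v n = ∑ k ∈ Finset.range (n + 1), a n k * v k) (m : ℕ)
    (v : lp (fun _ : ℕ => ℂ) q) (n : ℕ) :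
    signAverage A m v n =
      ∑ k ∈ Finset.range (n + 1), (signWeight m n k : ℂ) * (a n k * v k) := by
  induction m generalizing v with
  | zero => simp [signAverage, hA, signWeight]
  | succ m ih =>
    have e : signAverage A (m + 1) v n =
        ((1 - 1 / (2 * (m + 1)) : ℝ) : ℂ) * signAverage A m v n +
        ((1 / (2 * (m + 1)) : ℝ) : ℂ) *
          ((if n ≤ m then 1 else -1) * signAverage A m (signFlip q m v) n) := rfl
    rw [e, ih, ih, Finset.mul_sum, Finset.mul_sum, Finset.mul_sum, ← Finset.sum_add_distrib]
    refine Finset.sum_congr rfl fun k hk => ?_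
    have hk' : k ≤ n := by simpa [Nat.lt_succ_iff] using hk
    have hm : (m : ℂ) + 1 ≠ 0 := by exact_mod_cast m.succ_ne_zero
    rw [signFlip_apply, signWeight_succ]
    by_cases h1 : n ≤ m
    · have h2 : k ≤ m := hk'.trans h1
      rw [if_pos h1, if_pos h2, if_neg (by omega)]
      push_cast
      ring
    · by_cases h2 : k ≤ m
      · rw [if_neg h1, if_pos h2, if_pos (by omega)]
        push_cast
        field_simp
        ring
      · rw [if_neg h1, if_neg h2, if_neg (by omega)]
        push_cast
        ring

/-- Multiplying the entries `a n k` of a lower triangular matrix by `k / n` does not increase its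
operator norm on `ℓ^q`. -/
theorem exists_norm_le_of_lowerTriangular
    {A : lp (fun _ : ℕ => ℂ) q →L[ℂ] lp (fun _ : ℕ => ℂ) q}
    {a : ℕ → ℕ → ℂ} (hA : ∀ v n, A v n = ∑ k ∈ Finset.range (n + 1), a n k * v k)
    (v : lp (fun _ : ℕ => ℂ) q) :
    ∃ w : lp (fun _ : ℕ => ℂ) q, ‖w‖ ≤ ‖A‖ * ‖v‖ ∧ w 0 = a 0 0 * v 0 ∧
      ∀ n : ℕ, n * w n = ∑ k ∈ Finset.range (n + 1), (k : ℂ) * (a n k * v k) := by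
  have hb : ∀ m, ‖signAverage A m v‖ ≤ ‖A‖ * ‖v‖ := fun m =>
    (signAverage A m).le_of_opNorm_le (norm_signAverage_le A m) v
  -- Row `n` is final from stage `n` on, since the factors with `j ≥ n` equal `1`.
  have hstable : ∀ n m : ℕ, n ≤ m → signAverage A m v n = signAverage A n v n := by
    intro n m hm
    rw [signAverage_apply hA, signAverage_apply hA]
    refine Finset.sum_congr rfl fun k _ => ?_
    rw [signWeight, signWeight, Finset.prod_subset (Finset.range_subset_range.2 hm)]
    intro j _ hj
    exact if_neg fun h => hj (Finset.mem_range.2 h.2)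
  have ht : Tendsto (id fun m n => signAverage A m v n) atTop
      (𝓝 fun n => signAverage A n v n) :=
    tendsto_pi_nhds.2 fun n => tendsto_atTop_of_eventually_const (i₀ := n) (hstable n)
  -- A coordinatewise limit of a norm-bounded sequence stays in `ℓ^q` with the same bound.
  have hmem := lp.memℓp_of_tendsto (F := fun m => signAverage A m v)
    ((isBounded_iff_forall_norm_le).2 ⟨_, Set.forall_mem_range.2 hb⟩) ht
  refine ⟨⟨_, hmem⟩, lp.norm_le_of_tendsto (F := fun m => signAverage A m v)
    (Eventually.of_forall hb) ht, ?_, fun n => ?_⟩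
  -- The `(0, 0)` entry is unchanged, its weight being an empty product. The formula multiplied by
  -- `n` gives no information in this row.
  · change A v 0 = _
    rw [hA]
    simp
  · change n * signAverage A n v n = _
    rw [signAverage_apply hA, Finset.mul_sum]
    refine Finset.sum_congr rfl fun k hk => ?_
    have hk' : k ≤ n := by simpa [Nat.lt_succ_iff] using hk
    have h := min_mul_signWeight hk' n hk'
    rw [min_self] at h
    rw [← mul_assoc]
    congr 1
    simpa using congrArg (Complex.ofReal) h

end SchurMultiplier

/-! ### Multipliers are Volterra symbols. -/

theorem mult_le_volterraSymbols (hω : Tendsto (fun n => ω n / ω (n + 1)) atTop (𝓝 1)) {g : HolD}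
    (hg : g ∈ Mult p ω) : g ∈ VolterraSymbols p ω := by
  let e := LpA.toLpEquiv (p := p) hω
  let A : lp (fun _ : ℕ => ℂ) (ENNReal.ofReal p) →L[ℂ] lp (fun _ : ℕ => ℂ) (ENNReal.ofReal p) :=
    (e : LpA p ω →L[ℂ] _) ∘L mulOp hω hg ∘L (e.symm : _ →L[ℂ] LpA p ω)
  have hA : ∀ v n, A v n = ∑ k ∈ Finset.range (n + 1),
      (g.coeff (n - k) * ((ω n ^ (1 / p) : ℝ) : ℂ) / ((ω k ^ (1 / p) : ℝ) : ℂ)) * v k := by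
    intro v n
    obtain ⟨f, rfl⟩ := e.surjective v
    have h1 : A (e f) = e (mulOp hω hg f) := by simp [A]
    rw [h1, LpA.toLpEquiv_apply, coe_mulOp, mul_comm g, coeff_mul, Finset.sum_mul]
    refine Finset.sum_congr rfl fun k _ => ?_
    rw [LpA.toLpEquiv_apply]
    have : ((ω k ^ (1 / p) : ℝ) : ℂ) ≠ 0 := by exact_mod_cast (weight_rpow_pos p ω k).ne'
    field_simp
  -- The two terms bound `M_g` and `B` in `T_g = M_g - B`, where `A` is `M_g` transported to `ℓ^p`.
  refine ⟨‖mulOp hω hg‖ + ‖A‖, fun f => ?_⟩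
  obtain ⟨w, hw, hw0, hwn⟩ := exists_norm_le_of_lowerTriangular hA (e f)
  obtain ⟨b, rfl⟩ := e.surjective w
  have hpos : ∀ n, ((ω n ^ (1 / p) : ℝ) : ℂ) ≠ 0 := fun n => by
    exact_mod_cast (weight_rpow_pos p ω n).ne'
  have hb : volterra g f = ((mulOp hω hg f - b : LpA p ω) : HolD) := by
    refine ext_coeff fun n => ?_
    have hsub : ((mulOp hω hg f - b : LpA p ω) : HolD).coeff n =
        (g * f : HolD).coeff n - (b : HolD).coeff n := by
      have := coeff_add ((mulOp hω hg f - b : LpA p ω) : HolD) b n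
      rw [← Submodule.coe_add, sub_add_cancel, coe_mulOp] at this
      rw [this, add_sub_cancel_right]
    rw [hsub]
    -- At `n = 0`, `B` retains the constant coefficient of `g f`, so the difference vanishes there,
    -- as it does for `T_g f`.
    rcases eq_or_ne n 0 with rfl | hn
    · rw [LpA.toLpEquiv_apply, LpA.toLpEquiv_apply] at hw0
      rw [coeff_volterra_zero, mul_comm g, coeff_mul]
      have h0 := hpos 0
      field_simp at hw0
      simp [hw0, mul_comm]
    · have hn' : (n : ℂ) ≠ 0 := by exact_mod_cast hn
      refine mul_left_cancel₀ hn' ?_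
      have h1 : (n : ℂ) * (b : HolD).coeff n =
          ∑ k ∈ Finset.range (n + 1), (k : ℂ) * ((f : HolD).coeff k * g.coeff (n - k)) := by
        have h2 := hwn n
        rw [LpA.toLpEquiv_apply, ← mul_assoc] at h2
        refine mul_right_cancel₀ (hpos n) (h2.trans ?_)
        rw [Finset.sum_mul]
        refine Finset.sum_congr rfl fun k _ => ?_
        rw [LpA.toLpEquiv_apply]
        have := hpos k
        field_simp
      rw [coeff_volterra, mul_sub, h1, mul_comm g, coeff_mul, Finset.mul_sum,
        ← Finset.sum_sub_distrib]
      exact Finset.sum_congr rfl fun k _ => sub_mul _ _ _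
  have hm : volterra g f ∈ LpA p ω := hb ▸ (mulOp hω hg f - b).2
  refine ⟨hm, ?_⟩
  have he : (⟨volterra g f, hm⟩ : LpA p ω) = mulOp hω hg f - b := Subtype.ext hb
  rw [he, add_mul]
  refine (norm_sub_le _ _).trans (add_le_add ((mulOp hω hg).le_opNorm f) ?_)
  rwa [e.norm_map, e.norm_map] at hw

/-! ### Exponentials of multipliers. -/

theorem mulOp_pow_apply (hω : Tendsto (fun n => ω n / ω (n + 1)) atTop (𝓝 1)) {g : HolD}
    (hg : g ∈ Mult p ω) (n : ℕ) (f : LpA p ω) (z : 𝔻) :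
    (((mulOp hω hg) ^ n) f : HolD) z = g z ^ n * (f : HolD) z := by
  induction n with
  | zero => simp
  | succ n ih =>
    rw [pow_succ', mul_apply_eq_comp, coe_mulOp, HolD.mul_apply, ih, pow_succ']
    ring

/-- `Mult(ℓ^p_A(ω))` is closed under exponentials. -/
theorem exp_mem_mult (hω : Tendsto (fun n => ω n / ω (n + 1)) atTop (𝓝 1)) {g : HolD}
    (hg : g ∈ Mult p ω) : exp g ∈ Mult p ω := by
  have := LpA.completeSpace (p := p) hω
  intro f hf
  -- The operator exponential of `M_g` is multiplication by `exp g`: applying it to `f` and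
  -- evaluating at `z`, a continuous functional, turns its series into that of the scalar
  -- exponential.
  have hs := NormedSpace.exp_series_hasSum_exp' (𝕂 := ℂ) (mulOp hω hg)
  suffices h : exp g * f = ((NormedSpace.exp (mulOp hω hg) ⟨f, hf⟩ : LpA p ω) : HolD) from
    h ▸ Subtype.coe_prop _
  refine HolD.funext fun z => ?_
  let L : (LpA p ω →L[ℂ] LpA p ω) →+ ℂ :=
    { toFun := fun S => (S ⟨f, hf⟩ : HolD) z
      map_zero' := rfl
      map_add' := fun _ _ => rfl }
  have hL : Continuous L := (LpA.continuous_eval hω z).comp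
    (ContinuousLinearMap.apply ℂ (LpA p ω) (⟨f, hf⟩ : LpA p ω)).continuous
  have h1 := hs.map L hL
  have h2 := (NormedSpace.exp_series_hasSum_exp' (𝕂 := ℂ) (g z)).mul_right (f z)
  rw [← Complex.exp_eq_exp_ℂ, ← exp_apply, ← HolD.mul_apply] at h2
  refine h2.unique (h1.congr_fun fun n => ?_)
  change _ = ((n.factorial : ℂ)⁻¹) * (((mulOp hω hg) ^ n) ⟨f, hf⟩ : HolD) z
  rw [mulOp_pow_apply, smul_eq_mul, mul_assoc]

/-! ### Invertibility of `c - T_g`. -/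

/-- The `n`-th coefficient of `T_g f` involves only the `f̂(k)` with `k < n`, and the zeroth one is
`0`, so all coefficients of `f` vanish by strong induction. -/
theorem eq_zero_of_smul_eq_volterra {c : ℂ} (hc : c ≠ 0) {g f : HolD}
    (h : c • f = volterra g f) : f = 0 := by
  refine eq_zero_of_coeff f fun n => ?_
  induction n using Nat.strong_induction_on with
  | _ n ih =>
    have h1 : (n : ℂ) * (c * f.coeff n) = 0 := by
      rw [← coeff_smul, h, coeff_volterra]
      refine Finset.sum_eq_zero fun k hk => ?_
      rcases (Nat.lt_succ_iff.1 (Finset.mem_range.1 hk)).lt_or_eq with hk | rfl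
      · rw [ih k hk, zero_mul, mul_zero]
      · rw [sub_self, zero_mul]
    rcases eq_or_ne n 0 with rfl | hn
    · have h2 : c * f.coeff 0 = 0 := by rw [← coeff_smul, h, coeff_volterra_zero]
      exact (mul_eq_zero.1 h2).resolve_left hc
    · have h2 := (mul_eq_zero.1 h1).resolve_left (by exact_mod_cast hn)
      exact (mul_eq_zero.1 h2).resolve_left hc

theorem sub_volterraOp_injective {c : ℂ} (hc : c ≠ 0) (g : VolterraSymbols p ω) :
    Function.Injective (algebraMap ℂ (LpA p ω →L[ℂ] LpA p ω) c - volterraOp p ω g) := by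
  refine (injective_iff_map_eq_zero _).2 fun f hf => ?_
  refine Subtype.ext (eq_zero_of_smul_eq_volterra hc (g := (g : HolD)) ?_)
  have h : c • f - volterraOp p ω g f = 0 := hf
  exact congrArg Subtype.val (sub_eq_zero.1 h)

/-- Conjugating by `exp (c⁻¹ h)` replaces the symbol `g` by `g - h` in the equation
`c f - T_g f = F`. -/
theorem smul_exp_mul_sub_volterra {c : ℂ} (hc : c ≠ 0) {g h u F : HolD}
    (hu : c • u - volterra (g - h) u =
      exp (-(c⁻¹ • h)) * F - volterra (exp (-(c⁻¹ • h))) F) :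
    c • (exp (c⁻¹ • h) * u) - volterra g (exp (c⁻¹ • h) * u) = F := by
  have hE := exp_mul_exp_neg (c⁻¹ • h)
  -- The terms `F (e^{-h/c})'` cancel, leaving `c u' - u (g - h)' = e^{-h/c} F'`.
  have hd := congrArg derivation hu
  simp only [map_sub, LinearMap.sub_apply, Derivation.map_smul, derivation_volterra,
    derivation_mul] at hd
  have hsm : c • (c⁻¹ • derivation h) = derivation h := smul_inv_smul₀ hc _
  refine eq_of_derivation_eq ?_ ?_
  · simp only [map_sub, Derivation.map_smul, derivation_volterra, derivation_mul, derivation_exp]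
    have h1 : c • (exp (c⁻¹ • h) * derivation u + u * (exp (c⁻¹ • h) * c⁻¹ • derivation h)) =
        exp (c⁻¹ • h) * (c • derivation u) +
          u * exp (c⁻¹ • h) * (c • (c⁻¹ • derivation h)) := by
      simp only [smul_add, mul_smul_comm, mul_assoc]
    rw [h1, hsm]
    linear_combination exp (c⁻¹ • h) * hd + derivation F * hE
  · have hu0 : c * u 0 - volterra (g - h) u 0 =
        exp (-(c⁻¹ • h)) 0 * F 0 - volterra (exp (-(c⁻¹ • h))) F 0 :=
      congrArg (fun f : HolD => f 0) hu
    have hE0 : exp (c⁻¹ • h) 0 * exp (-(c⁻¹ • h)) 0 = 1 := congrArg (fun f : HolD => f 0) hE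
    change c * (exp (c⁻¹ • h) 0 * u 0) - volterra g (exp (c⁻¹ • h) * u) 0 = F 0
    rw [volterra_apply_zero] at hu0 ⊢
    rw [volterra_apply_zero] at hu0
    linear_combination exp (c⁻¹ • h) 0 * hu0 + F 0 * hE0

/-- A perturbation argument: the multiplier part `h` of the symbol is absorbed by the factor
`e^{h/c}`, whatever its size, and only `g - h` has to be small. -/
theorem isUnit_sub_volterraOp (hω : Tendsto (fun n => ω n / ω (n + 1)) atTop (𝓝 1)) {c : ℂ}
    (hc : c ≠ 0) {g h : VolterraSymbols p ω} (hh : (h : HolD) ∈ Mult p ω)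
    (hgh : ‖g - h‖ < ‖c‖) :
    IsUnit (algebraMap ℂ (LpA p ω →L[ℂ] LpA p ω) c - volterraOp p ω g) := by
  have := LpA.completeSpace (p := p) hω
  refine ContinuousLinearMap.isUnit_iff_bijective.2 ⟨sub_volterraOp_injective hc g, fun F => ?_⟩
  have h1 : c⁻¹ • (h : HolD) ∈ Mult p ω := (Mult p ω).smul_mem hh _
  have hE := exp_mem_mult hω h1
  have hE' := exp_mem_mult hω ((Mult p ω).neg_mem h1)
  let E' : VolterraSymbols p ω := ⟨_, mult_le_volterraSymbols hω hE'⟩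
  have hunit : IsUnit (algebraMap ℂ (LpA p ω →L[ℂ] LpA p ω) c - volterraOp p ω (g - h)) :=
    spectrum.mem_resolventSet_of_norm_lt (by rwa [← norm_symbol])
  obtain ⟨u, hu⟩ := (ContinuousLinearMap.isUnit_iff_bijective.1 hunit).2
    (mulOp hω hE' F - volterraOp p ω E' F)
  refine ⟨mulOp hω hE u, Subtype.ext ?_⟩
  exact smul_exp_mul_sub_volterra hc (congrArg Subtype.val hu)

end VolterraLp

end

theorem theorem1p2 (p : ℝ) [Fact (1 < p)] (ω : VolterraLp.Weight)
    (hω : Tendsto (fun n => ω n / ω (n + 1)) atTop (𝓝 1)) :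
    (∀ g ∈ VolterraLp.Mult p ω, g ∈ VolterraLp.VolterraSymbols p ω) ∧
    ∀ g ∈ closure {h : VolterraLp.VolterraSymbols p ω | (h : VolterraLp.HolD) ∈ VolterraLp.Mult p ω},
      spectrum ℂ (VolterraLp.volterraOp p ω g) = {0} := by
  refine ⟨fun g hg => VolterraLp.mult_le_volterraSymbols hω hg, fun g hg => ?_⟩
  have := VolterraLp.LpA.completeSpace (p := p) hω
  -- The spectrum is nonempty, so it suffices to exclude every `c ≠ 0`. The approximating multiplier
  -- may depend on `c`.
  refine (spectrum.nonempty (VolterraLp.volterraOp p ω g)).subset_singleton_iff.1 fun c hc => ?_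
  by_contra hc0
  obtain ⟨h, hh, hgh⟩ := Metric.mem_closure_iff.1 hg ‖c‖ (norm_pos_iff.2 hc0)
  rw [dist_eq_norm] at hgh
  exact hc (VolterraLp.isUnit_sub_volterraOp hω hc0 hh hgh)
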